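/- Let $p$ be a positive integer, let $M_1,\dots,M_N$ be real $d\times d$ matrices, and let $\mathbb P=[p_{ij}]$ be an $N\times N$ (row-)stochastic matrix. For each initial state $\sigma_0\in\{1,\dots,N\}$ let $\{\sigma_k\}_{k\ge 0}$ be a time-homogeneous Markov chain on $\{1,\dots,N\}$ with transition matrix $\mathbb P$ and constant initial state $\sigma_0$, put $A_k=M_{\sigma_k}$, and let $x(k;x_0,\sigma_0)$ be the solution of $x(k+1)=A_kx(k)$, $x(0)=x_0\in\mathbb R^d$. Write $M^{\otimes p}$ and $x^{\otimes p}$ for the $p$-fold Kronecker powers of a matrix and of a vector, let $\|\cdot\|$ be arbitrary norms on $\mathbb R^d$, $\mathbb R^{d\times d}$ and $\mathbb R^{d^p}$, and put $$\rho_{p,A}=\lim_{k\to\infty}\big(E[\|A_k\cdots A_1\|^p]\big)^{1/(pk)}.$$ Assume that either $p=2$, or $p=1$ and there is a proper cone $K\subset\mathbb R^d$ (closed under multiplication by nonnegative scalars, closed, convex, with nonempty interior, and such that $x,-x\in K$ implies $x=0$) with $M_iK\subset K$ for all $i$. Then the limit $\rho_{p,A}$ exists for every $\sigma_0$, and the following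 conditions are equivalent: (i) $\rho_{p,A}<1$ for every $\sigma_0$; (ii) ($p$th mean stability) there exist $C,\beta>0$ such that $E[\|x(k;x_0,\sigma_0)\|^p]\le Ce^{-\beta k}\|x_0\|^p$ for all $x_0\in\mathbb R^d$, all $\sigma_0$ and all $k\ge 0$; (iii) ($p$th moment stability) there exist $C,\beta>0$ such that $\|E[x(k;x_0,\sigma_0)^{\otimes p}]\|\le Ce^{-\beta k}\|x_0\|^p$ for all $x_0\in\mathbb R^d$, all $\sigma_0$ and all $k\ge 0$; (iv) the $Nd^p\times Nd^p$ matrix $T_p=(\mathbb P^\top\otimes I_{d^p})\,\mathrm{diag}(M_1^{\otimes p},\dots,M_N^{\otimes p})$ has spectral radius $\rho(T_p)<1$. -/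

import Mathlib

open MeasureTheory Filter Topology
open scoped Kronecker Matrix

noncomputable section

namespace SwitchedSystem

/-- A norm on a real vector space: a seminorm vanishing only at `0`. -/
def IsNorm {V : Type*} [AddCommGroup V] [Module ℝ V] (n : Seminorm ℝ V) : Prop :=
  ∀ x : V, n x = 0 → x = 0

/-- A proper cone: closed under multiplication by nonnegative scalars, closed, convex, solid
(nonempty interior) and pointed (contains no line). -/
structure IsProperCone {d : ℕ} (K : Set (Fin d → ℝ)) : Prop where
  smul_mem : ∀ c : ℝ, 0 ≤ c → ∀ x ∈ K, c • x ∈ K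
  isClosed : IsClosed K
  convex : Convex ℝ K
  solid : (interior K).Nonempty
  pointed : ∀ x, x ∈ K → -x ∈ K → x = 0

/-- The family `M` of matrices leaves the set `K` invariant. -/
def LeavesInvariant {N d : ℕ} (M : Fin N → Matrix (Fin d) (Fin d) ℝ)
    (K : Set (Fin d → ℝ)) : Prop :=
  ∀ i, ∀ x ∈ K, M i *ᵥ x ∈ K

/-- The Kronecker power `x^{⊗p}` of a vector `x ∈ ℝ^d`. Its `d^p` coordinates are indexed by
multi-indices `Fin p → Fin d`. -/
def vecKronPow {d : ℕ} (p : ℕ) (x : Fin d → ℝ) : (Fin p → Fin d) → ℝ :=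
  fun f => ∏ l, x (f l)

/-- The Kronecker power `M^{⊗p}` of a `d × d` matrix, a `d^p × d^p` matrix with rows and columns
indexed by multi-indices `Fin p → Fin d`. -/
def kronPow {d : ℕ} (p : ℕ) (M : Matrix (Fin d) (Fin d) ℝ) :
    Matrix (Fin p → Fin d) (Fin p → Fin d) ℝ :=
  Matrix.of fun f g => ∏ l, M (f l) (g l)

/-- Under the identification `(Fin 1 → Fin d) = Fin d` one has `M^{⊗1} = M`. -/
theorem kronPow_one {d : ℕ} (M : Matrix (Fin d) (Fin d) ℝ) :
    (kronPow 1 M).submatrix (fun i _ => i) (fun j _ => j) = M := by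
  ext i j
  simp [kronPow]

/-- Under the identification of `Fin (p + 1) → Fin d` with `(Fin p → Fin d) × Fin d` one has
`M^{⊗(p+1)} = M^{⊗p} ⊗ M`. -/
theorem kronPow_succ {d : ℕ} (p : ℕ) (M : Matrix (Fin d) (Fin d) ℝ) :
    (kronPow (p + 1) M).submatrix
        (fun u : (Fin p → Fin d) × Fin d => (Fin.snoc u.1 u.2 : Fin (p + 1) → Fin d))
        (fun u : (Fin p → Fin d) × Fin d => (Fin.snoc u.1 u.2 : Fin (p + 1) → Fin d)) =
      kronPow p M ⊗ₖ M := by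
  ext u v
  simp [kronPow, Fin.prod_univ_castSucc]

/-- `σ` is, under `μ`, a time-homogeneous Markov chain with values in `Fin N`, transition
probability matrix `P` and constant initial state `s`. -/
structure IsMarkovChain {N : ℕ} (P : Matrix (Fin N) (Fin N) ℝ) (s : Fin N)
    {Ω : Type*} [MeasurableSpace Ω] (μ : Measure Ω) (σ : ℕ → Ω → Fin N) : Prop where
  measurable : ∀ k, Measurable (σ k)
  initial : ∀ᵐ ω ∂μ, σ 0 ω = s
  transition : ∀ (k : ℕ) (i : ℕ → Fin N) (j : Fin N), μ {ω | ∀ l ≤ k, σ l ω = i l} ≠ 0 →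
    ProbabilityTheory.cond μ {ω | ∀ l ≤ k, σ l ω = i l} {ω | σ (k + 1) ω = j} =
      ENNReal.ofReal (P (i k) j)

/-- The trajectory of `x(k+1) = A_k x(k)`, `A_k = M_{i_k}`, along a switching sequence `i`. -/
def traj {N d : ℕ} (M : Fin N → Matrix (Fin d) (Fin d) ℝ) (i : ℕ → Fin N) (x₀ : Fin d → ℝ) :
    ℕ → Fin d → ℝ
  | 0 => x₀
  | k + 1 => M (i k) *ᵥ traj M i x₀ k

/-- The product `A_k ⋯ A_1`, `A_k = M_{i_k}`, along a switching sequence `i`. -/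
def matProd {N d : ℕ} (M : Fin N → Matrix (Fin d) (Fin d) ℝ) (i : ℕ → Fin N) :
    ℕ → Matrix (Fin d) (Fin d) ℝ
  | 0 => 1
  | k + 1 => M (i (k + 1)) * matProd M i k

/-- The sequence `(E[‖A_k ⋯ A_1‖^p])^{1/(pk)}`, with `A_k = M_{σ_k}`. -/
def radiusSeq {N d : ℕ} (p : ℕ) (M : Fin N → Matrix (Fin d) (Fin d) ℝ)
    (nMat : Seminorm ℝ (Matrix (Fin d) (Fin d) ℝ))
    {Ω : Type*} [MeasurableSpace Ω] (μ : Measure Ω) (σ : ℕ → Ω → Fin N) (k : ℕ) : ℝ :=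
  (∫ ω, nMat (matProd M (fun l => σ l ω) k) ^ p ∂μ) ^ (1 / ((p : ℝ) * (k : ℝ)))

/-- The `L^p`-norm joint spectral radius `ρ_{p,A} = lim_k (E[‖A_k ⋯ A_1‖^p])^{1/(pk)}`. -/
def pRadius {N d : ℕ} (p : ℕ) (M : Fin N → Matrix (Fin d) (Fin d) ℝ)
    (nMat : Seminorm ℝ (Matrix (Fin d) (Fin d) ℝ))
    {Ω : Type*} [MeasurableSpace Ω] (μ : Measure Ω) (σ : ℕ → Ω → Fin N) : ℝ :=
  limUnder atTop (radiusSeq p M nMat μ σ)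

/-- Exponential stability in `p`th mean; `σ s` is the chain started at `s`. -/
def IsMeanStable {N d : ℕ} (p : ℕ) (M : Fin N → Matrix (Fin d) (Fin d) ℝ)
    (nVec : Seminorm ℝ (Fin d → ℝ)) {Ω : Fin N → Type*} [∀ s, MeasurableSpace (Ω s)]
    (μ : ∀ s, Measure (Ω s)) (σ : ∀ s, ℕ → Ω s → Fin N) : Prop :=
  ∃ C > (0 : ℝ), ∃ β > (0 : ℝ), ∀ (s : Fin N) (x₀ : Fin d → ℝ) (k : ℕ),
    ∫ ω, nVec (traj M (fun l => σ s l ω) x₀ k) ^ p ∂(μ s) ≤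
      C * Real.exp (-β * k) * nVec x₀ ^ p

/-- Exponential stability in `p`th moment; `σ s` is the chain started at `s`. -/
def IsMomentStable {N d : ℕ} (p : ℕ) (M : Fin N → Matrix (Fin d) (Fin d) ℝ)
    (nVec : Seminorm ℝ (Fin d → ℝ)) (nTens : Seminorm ℝ ((Fin p → Fin d) → ℝ))
    {Ω : Fin N → Type*} [∀ s, MeasurableSpace (Ω s)]
    (μ : ∀ s, Measure (Ω s)) (σ : ∀ s, ℕ → Ω s → Fin N) : Prop :=
  ∃ C > (0 : ℝ), ∃ β > (0 : ℝ), ∀ (s : Fin N) (x₀ : Fin d → ℝ) (k : ℕ),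
    nTens (∫ ω, vecKronPow p (traj M (fun l => σ s l ω) x₀ k) ∂(μ s)) ≤
      C * Real.exp (-β * k) * nVec x₀ ^ p

/-- The `N d^p × N d^p` matrix `T_p = (Pᵀ ⊗ I) diag(M_1^{⊗p}, …, M_N^{⊗p})`. The reindexing only
puts the block index of `Matrix.blockDiagonal` first, as in the Kronecker product. -/
def liftedMatrix {N d : ℕ} (p : ℕ) (P : Matrix (Fin N) (Fin N) ℝ)
    (M : Fin N → Matrix (Fin d) (Fin d) ℝ) :
    Matrix (Fin N × (Fin p → Fin d)) (Fin N × (Fin p → Fin d)) ℝ :=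
  (Pᵀ ⊗ₖ (1 : Matrix (Fin p → Fin d) (Fin p → Fin d) ℝ)) *
    Matrix.reindex (Equiv.prodComm _ _) (Equiv.prodComm _ _)
      (Matrix.blockDiagonal fun i => kronPow p (M i))

/-- The spectral radius of a real square matrix: the largest modulus of a complex eigenvalue. -/
def specRadius {n : Type*} [Fintype n] [DecidableEq n] (T : Matrix n n ℝ) : ENNReal :=
  spectralRadius ℂ (T.map (algebraMap ℝ ℂ))

end SwitchedSystem

end

/-! Averaging the Kronecker power of the product separately on each event that the current state is
`j` gives a vector in `ℝ^(N d^p)`. By the Markov property this vector evolves linearly under `T_p`,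
whatever the initial tensor (`liftedMean_succ`). All moments are thus orbits of a single matrix,
bounded in norm by a constant times `E‖A_k ⋯ A_1‖^p`.

The hypothesis on `p` supplies the reverse bound. There are a linear functional `f` and a tensor `w
= ∑ e_a^{⊗p}` with `‖A‖^p ≤ D f(A^{⊗p} w)` for every product `A` of the `M_i` (`IsDominated`). For
`p = 2` the right side is the squared Frobenius norm; for `p = 1` it comes from an interior point of
`K` and a functional dominating the norm on `K`. Hence `E‖A_k ⋯ A_1‖^p` is comparable to `‖T_p^k v‖`
for one fixed vector `v`.

Such an orbit norm is submultiplicative up to a constant, by Cayley–Hamilton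
(`exists_norm_orbit_submul`), so Fekete's lemma yields the limit. The equivalences form a cycle. A
radius below 1 means exponential decay of the mean product norm, which bounds trajectories; the norm
of a mean is at most the mean of the norm; moment decay along the vectors `e_a` gives, by
domination, decay of the mean product norm and so of every entry of `T_p^k`; Gelfand's formula
closes the cycle. -/

namespace SwitchedSystem

/-! ### Exponential decay and limits of roots -/

/-- A real sequence bounded above by a decaying exponential. -/
def ExpDecay (b : ℕ → ℝ) : Prop :=
  ∃ C > (0 : ℝ), ∃ β > (0 : ℝ), ∀ k : ℕ, b k ≤ C * Real.exp (-β * k)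

theorem ExpDecay.mono {a b : ℕ → ℝ} (hb : ExpDecay b) (h : ∀ k, a k ≤ b k) : ExpDecay a := by
  obtain ⟨C, hC, β, hβ, H⟩ := hb
  exact ⟨C, hC, β, hβ, fun k => (h k).trans (H k)⟩

theorem ExpDecay.const_mul {b : ℕ → ℝ} (hb : ExpDecay b) {c : ℝ} (hc : 0 ≤ c) :
    ExpDecay fun k => c * b k := by
  obtain ⟨C, hC, β, hβ, H⟩ := hb
  refine ⟨(c + 1) * C, by positivity, β, hβ, fun k => ?_⟩
  have h1 : c * b k ≤ c * (C * Real.exp (-β * k)) := by gcongr; exact H k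
  have h2 : 0 < C * Real.exp (-β * k) := by positivity
  linarith

theorem ExpDecay.add {a b : ℕ → ℝ} (ha : ExpDecay a) (hb : ExpDecay b) :
    ExpDecay fun k => a k + b k := by
  obtain ⟨C, hC, β, hβ, H⟩ := ha
  obtain ⟨C', hC', β', hβ', H'⟩ := hb
  refine ⟨C + C', by positivity, min β β', lt_min hβ hβ', fun k => ?_⟩
  have h1 : C * Real.exp (-β * k) ≤ C * Real.exp (-min β β' * k) := by
    gcongr; exact min_le_left _ _
  have h2 : C' * Real.exp (-β' * k) ≤ C' * Real.exp (-min β β' * k) := by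
    gcongr; exact min_le_right _ _
  linarith [H k, H' k]

theorem ExpDecay.sum {ι : Type*} (t : Finset ι) {b : ι → ℕ → ℝ} (hb : ∀ i ∈ t, ExpDecay (b i)) :
    ExpDecay fun k => ∑ i ∈ t, b i k := by
  classical
  induction t using Finset.induction_on with
  | empty => exact ⟨1, one_pos, 1, one_pos, fun k => by simp; positivity⟩
  | insert i t hi ih =>
    simp only [Finset.sum_insert hi]
    exact (hb i (by simp)).add (ih fun j hj => hb j (by simp [hj]))

theorem expDecay_of_succ {b : ℕ → ℝ} (h : ExpDecay fun k => b (k + 1)) : ExpDecay b := by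
  obtain ⟨C, hC, β, hβ, H⟩ := h
  refine ⟨C * Real.exp β + |b 0|, by positivity, β, hβ, fun k => ?_⟩
  cases k with
  | zero =>
    have : 0 < C * Real.exp β := by positivity
    simp only [CharP.cast_eq_zero, mul_zero, Real.exp_zero, mul_one]
    linarith [le_abs_self (b 0)]
  | succ k =>
    have h1 : C * Real.exp (-β * k) = C * Real.exp β * Real.exp (-β * (k + 1 : ℕ)) := by
      rw [mul_assoc, ← Real.exp_add]
      congr 2
      push_cast
      ring
    have h2 : 0 ≤ |b 0| * Real.exp (-β * (k + 1 : ℕ)) := by positivity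
    rw [add_mul]
    linarith [H k]

theorem expDecay_of_eventually_le_pow {b : ℕ → ℝ} {r : ℝ} (hr0 : 0 < r) (hr : r < 1)
    (h : ∀ᶠ k in atTop, b k ≤ r ^ k) : ExpDecay b := by
  obtain ⟨n, hn⟩ := eventually_atTop.1 h
  have hshift : ∀ m, ExpDecay (fun k => b (k + m)) → ExpDecay b := by
    intro m
    induction m with
    | zero => exact id
    | succ m ih =>
      intro hm
      refine ih (expDecay_of_succ (hm.mono fun k => le_of_eq ?_))
      congr 1
      ring
  refine hshift n ⟨1, one_pos, -Real.log r, by linarith [Real.log_neg hr0 hr], fun k => ?_⟩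
  rw [neg_neg, mul_comm (Real.log r), one_mul, Real.exp_nat_mul, Real.exp_log hr0]
  exact (hn _ (by omega)).trans (pow_le_pow_of_le_one hr0.le hr.le (by omega))

theorem expDecay_of_eventually_root_lt {b : ℕ → ℝ} (hb : ∀ k, 0 ≤ b k) {q r : ℝ} (hq : 0 < q)
    (hr : r < 1) (h : ∀ᶠ k : ℕ in atTop, b k ^ (1 / (q * (k : ℝ))) < r) : ExpDecay b := by
  have hr0 : 0 < r := by
    obtain ⟨k, hk⟩ := h.exists
    exact (Real.rpow_nonneg (hb k) _).trans_lt hk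
  refine expDecay_of_eventually_le_pow (r := r ^ q) (by positivity)
    (Real.rpow_lt_one hr0.le hr hq) ?_
  filter_upwards [h, eventually_gt_atTop 0] with k hk hk0
  have hk0' : (0 : ℝ) < k := by exact_mod_cast hk0
  rw [← Real.rpow_natCast, ← Real.rpow_mul hr0.le]
  calc b k = (b k ^ (1 / (q * (k : ℝ)))) ^ (q * (k : ℝ)) := by
        rw [← Real.rpow_mul (hb k), one_div_mul_cancel (by positivity), Real.rpow_one]
    _ ≤ r ^ (q * (k : ℝ)) := by
        gcongr
        exact Real.rpow_nonneg (hb k) _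

/-- The root of the constant, `C ^ (1 / (q k))`, tends to 1, so the limit is at most `exp (-β / q)`.
-/
theorem lt_one_of_tendsto_root {b : ℕ → ℝ} (hb : ∀ k, 0 ≤ b k) {q L : ℝ} (hq : 0 < q)
    (hL : Tendsto (fun k : ℕ => b k ^ (1 / (q * (k : ℝ)))) atTop (𝓝 L)) (h : ExpDecay b) :
    L < 1 := by
  obtain ⟨C, hC, β, hβ, H⟩ := h
  have hlim : Tendsto (fun k : ℕ => C ^ (1 / (q * (k : ℝ))) * Real.exp (-β / q)) atTop
      (𝓝 (C ^ (0 : ℝ) * Real.exp (-β / q))) := by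
    refine Tendsto.mul_const _ (Tendsto.rpow tendsto_const_nhds ?_ (Or.inl hC.ne'))
    exact Tendsto.div_atTop tendsto_const_nhds
      (tendsto_natCast_atTop_atTop.const_mul_atTop hq)
  have hle : L ≤ C ^ (0 : ℝ) * Real.exp (-β / q) := by
    refine le_of_tendsto_of_tendsto hL hlim ?_
    filter_upwards [eventually_gt_atTop 0] with k hk0
    have hk0' : (0 : ℝ) < k := by exact_mod_cast hk0
    calc b k ^ (1 / (q * (k : ℝ))) ≤ (C * Real.exp (-β * k)) ^ (1 / (q * (k : ℝ))) :=
          Real.rpow_le_rpow (hb k) (H k) (by positivity)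
      _ = _ := by
          rw [Real.mul_rpow hC.le (Real.exp_pos _).le, ← Real.exp_mul]
          congr 2
          field_simp
  rw [Real.rpow_zero, one_mul] at hle
  exact hle.trans_lt (Real.exp_lt_one_iff.2 (div_neg_of_neg_of_pos (by linarith) hq))

/-- Fekete's lemma for sequences that are submultiplicative up to a constant. -/
theorem exists_tendsto_root {a : ℕ → ℝ} (ha : ∀ k, 0 ≤ a k) {D : ℝ}
    (h : ∀ k l, a (k + l) ≤ D * a k * a l) {q : ℝ} (hq : 0 < q) :
    ∃ L, Tendsto (fun k : ℕ => a k ^ (1 / (q * (k : ℝ)))) atTop (𝓝 L) := by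
  -- One vanishing term makes all later terms vanish, and the logarithm below is then unavailable.
  by_cases h0 : ∃ m, a m = 0
  · obtain ⟨m, hm⟩ := h0
    refine ⟨0, tendsto_const_nhds.congr' ?_⟩
    filter_upwards [eventually_ge_atTop (m + 1)] with k hk
    have hk0 : (0 : ℝ) < k := by exact_mod_cast (by omega : 0 < k)
    have : a k = 0 := by
      obtain ⟨l, rfl⟩ := Nat.exists_eq_add_of_le (show m ≤ k by omega)
      refine le_antisymm ?_ (ha _)
      simpa [hm] using h m l
    rw [this, Real.zero_rpow (by positivity)]
  · push Not at h0
    have hpos : ∀ k, 0 < a k := fun k => (ha k).lt_of_ne' (h0 k)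
    obtain ⟨E, hE, hDE⟩ : ∃ E : ℝ, 0 < E ∧ D ≤ E := ⟨max D 1, by positivity, le_max_left _ _⟩
    have hE' : ∀ k l, a (k + l) ≤ E * a k * a l := fun k l => (h k l).trans (by
      have := (hpos k).le
      have := (hpos l).le
      gcongr)
    -- Multiplying by `E` absorbs the constant: `E * a` is genuinely submultiplicative.
    set u : ℕ → ℝ := fun k => Real.log (E * a k) with hu
    have hEa : ∀ k, 0 < E * a k := fun k => mul_pos hE (hpos k)
    have hsub : Subadditive u := by
      intro m n
      rw [hu]
      simp only
      rw [← Real.log_mul (hEa m).ne' (hEa n).ne']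
      refine Real.log_le_log (hEa _) ?_
      calc E * a (m + n) ≤ E * (E * a m * a n) := by gcongr; exact hE' m n
        _ = _ := by ring
    have hform : (fun k : ℕ => Real.exp (u k / k / q - Real.log E / q / k)) =ᶠ[atTop]
        fun k : ℕ => a k ^ (1 / (q * (k : ℝ))) := by
      filter_upwards [eventually_gt_atTop 0] with k hk
      have hk0 : (0 : ℝ) < k := by exact_mod_cast hk
      rw [Real.rpow_def_of_pos (hpos k), hu]
      simp only
      rw [Real.log_mul hE.ne' (hpos k).ne']
      congr 1
      field_simp
      ring
    have hEk : Tendsto (fun k : ℕ => Real.log E / q / k) atTop (𝓝 0) :=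
      tendsto_const_div_atTop_nhds_zero_nat _
    -- If `u n / n` is unbounded below, subadditivity forces it to `-∞`, and the roots tend to 0.
    by_cases hb : BddBelow (Set.range fun n => u n / n)
    · exact ⟨_, ((Real.continuous_exp.tendsto _).comp
        (((hsub.tendsto_lim hb).div_const q).sub hEk)).congr' hform⟩
    · have hbot : Tendsto (fun n : ℕ => u n / n) atTop atBot := by
        refine tendsto_atBot.2 fun B => ?_
        have : ∃ n : ℕ, n ≠ 0 ∧ u n / n < B := by
          by_contra! hcon
          -- The `0` covers the index `n = 0`, where the quotient is 0 by convention.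
          refine hb ⟨min B 0, ?_⟩
          rintro _ ⟨n, rfl⟩
          rcases eq_or_ne n 0 with rfl | hn
          · simp
          · exact (min_le_left _ _).trans (hcon n hn)
        obtain ⟨n, hn, hlt⟩ := this
        exact (hsub.eventually_div_lt_of_div_lt hn hlt).mono fun k hk => hk.le
      have hbot' : Tendsto (fun n : ℕ => u n / n / q - Real.log E / q / n) atTop atBot := by
        simp only [sub_eq_add_neg]
        exact (hbot.atBot_div_const hq).atBot_add hEk.neg
      exact ⟨0, (Real.tendsto_exp_atBot.comp hbot').congr' hform⟩

/-! ### Comparison of norms in finite dimension, and functionals on proper cones -/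

theorem exists_seminorm_le {E : Type*} [NormedAddCommGroup E] [NormedSpace ℝ E]
    [FiniteDimensional ℝ E] (n : Seminorm ℝ E) : ∃ C > (0 : ℝ), ∀ x, n x ≤ C * ‖x‖ := by
  let b := Module.finBasis ℝ E
  refine ⟨∑ i, ‖(b.coord i).toContinuousLinearMap‖ * n (b i) + 1, by positivity, fun x => ?_⟩
  calc n x = n (∑ i, b.coord i x • b i) := by simp
    _ ≤ ∑ i, n (b.coord i x • b i) := by
        exact Finset.le_sum_of_subadditive n (map_zero n).le (map_add_le_add n) _ _
    _ ≤ ∑ i, ‖(b.coord i).toContinuousLinearMap‖ * n (b i) * ‖x‖ := by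
        refine Finset.sum_le_sum fun i _ => ?_
        rw [map_smul_eq_mul]
        calc _ ≤ (‖(b.coord i).toContinuousLinearMap‖ * ‖x‖) * n (b i) := by
              gcongr
              exact (b.coord i).toContinuousLinearMap.le_opNorm x
          _ = _ := by ring
    _ ≤ _ := by
        rw [← Finset.sum_mul, add_mul, one_mul]
        linarith [norm_nonneg x]

/-- The continuous function `n` attains a positive minimum on the unit sphere, which is empty only
if the space is trivial. -/
theorem IsNorm.exists_norm_le {E : Type*} [NormedAddCommGroup E] [NormedSpace ℝ E]
    [FiniteDimensional ℝ E] {n : Seminorm ℝ E} (hn : IsNorm n) :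
    ∃ C > (0 : ℝ), ∀ x, ‖x‖ ≤ C * n x := by
  have : ProperSpace E := FiniteDimensional.proper ℝ E
  obtain ⟨C, hC, hle⟩ := exists_seminorm_le n
  have hcont : Continuous n := Seminorm.continuous_of_le (q := C.toNNReal • normSeminorm ℝ E)
    (by
      change Continuous fun x => (C.toNNReal : ℝ) * ‖x‖
      fun_prop)
    (fun x => by
      change n x ≤ (C.toNNReal : ℝ) * ‖x‖
      rw [Real.coe_toNNReal _ hC.le]
      exact hle x)
  rcases (Metric.sphere (0 : E) 1).eq_empty_or_nonempty with he | hne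
  · refine ⟨1, one_pos, fun x => ?_⟩
    have hx : x = 0 := by
      by_contra hx
      have : ‖x‖⁻¹ • x ∈ Metric.sphere (0 : E) 1 := by
        simp [norm_smul, hx]
      simp [he] at this
    simp [hx]
  · obtain ⟨x₀, hx₀, hmin⟩ := (isCompact_sphere (0 : E) 1).exists_isMinOn hne hcont.continuousOn
    have hx0 : x₀ ≠ 0 := by
      rintro rfl
      simp at hx₀
    have hm : 0 < n x₀ := (apply_nonneg n x₀).lt_of_ne' fun h => hx0 (hn _ h)
    refine ⟨(n x₀)⁻¹, inv_pos.2 hm, fun x => ?_⟩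
    rcases eq_or_ne x 0 with rfl | hx
    · simp
    have hxs : ‖x‖⁻¹ • x ∈ Metric.sphere (0 : E) 1 := by
      simp [norm_smul, hx]
    have := hmin hxs
    simp only [Set.mem_ofPred_eq, map_smul_eq_mul, norm_inv, norm_norm] at this
    have hxn : 0 < ‖x‖ := norm_pos_iff.2 hx
    rw [inv_mul_eq_div, le_div_iff₀ hm]
    rw [inv_mul_eq_div, le_div_iff₀ hxn] at this
    linarith

/-- A closed pointed cone has a linear functional dominating the norm on it. -/
theorem IsProperCone.exists_functional {d : ℕ} {K : Set (Fin d → ℝ)} (hK : IsProperCone K) :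
    ∃ f : (Fin d → ℝ) →ₗ[ℝ] ℝ, ∀ x ∈ K, ‖x‖ ≤ f x := by
  have h0 : (0 : Fin d → ℝ) ∈ K := by
    obtain ⟨x, hx⟩ := hK.solid
    simpa using hK.smul_mem 0 le_rfl x (interior_subset hx)
  set S := K ∩ Metric.sphere (0 : Fin d → ℝ) 1 with hS
  have hSc : IsCompact S := (isCompact_sphere _ _).inter_left hK.isClosed
  -- For each `x` in the compact base, separating `-x` from `K` gives a functional nonnegative on
  -- `K` and positive near `x`. Finitely many of these neighbourhoods suffice, and the functionals
  -- add up.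
  obtain ⟨f, hf0, hf⟩ : ∃ f : (Fin d → ℝ) →L[ℝ] ℝ, (∀ x ∈ K, 0 ≤ f x) ∧ ∀ x ∈ S ∩ K, 0 < f x := by
    refine hSc.induction_on
      (p := fun s => ∃ f : (Fin d → ℝ) →L[ℝ] ℝ, (∀ x ∈ K, 0 ≤ f x) ∧ ∀ x ∈ s ∩ K, 0 < f x)
      ⟨0, by simp, by simp⟩ ?_ ?_ ?_
    · rintro s t hst ⟨f, hf, hft⟩
      exact ⟨f, hf, fun x hx => hft x ⟨hst hx.1, hx.2⟩⟩
    · rintro s t ⟨f, hf, hfs⟩ ⟨g, hg, hgt⟩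
      refine ⟨f + g, fun x hx => add_nonneg (hf x hx) (hg x hx), ?_⟩
      rintro x ⟨hx | hx, hxK⟩
      · exact add_pos_of_pos_of_nonneg (hfs x ⟨hx, hxK⟩) (hg x hxK)
      · exact add_pos_of_nonneg_of_pos (hf x hxK) (hgt x ⟨hx, hxK⟩)
    · intro x hx
      have hx0 : x ≠ 0 := by
        rintro rfl
        simpa using hx.2
      have hnx : -x ∉ K := fun h => hx0 (hK.pointed x hx.1 h)
      obtain ⟨f, u, hfu, hu⟩ := geometric_hahn_banach_point_closed hK.convex hK.isClosed hnx
      have hu0 : u < 0 := by simpa using hu 0 h0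
      refine ⟨{y | 0 < f y}, mem_nhdsWithin_of_mem_nhds
        ((isOpen_lt continuous_const f.continuous).mem_nhds ?_), f, fun y hy => ?_, fun y hy => hy.1⟩
      · have : f (-x) < 0 := hfu.trans hu0
        rw [map_neg] at this
        simpa using this
      · by_contra! hneg
        -- If `f y < 0`, this scaling moves `y` within `K` to a point where `f` equals `u`, against
        -- strict separation.
        have := hu _ (hK.smul_mem (u / f y) (div_nonneg_of_nonpos hu0.le hneg.le) y hy)
        rw [map_smul, smul_eq_mul, div_mul_cancel₀ _ hneg.ne] at this
        exact lt_irrefl _ this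
  have key : ∃ m > 0, ∀ x ∈ S, m ≤ f x := by
    rcases S.eq_empty_or_nonempty with he | hne
    · exact ⟨1, one_pos, by simp [he]⟩
    · obtain ⟨x₀, hx₀, hmin⟩ := hSc.exists_isMinOn hne f.continuous.continuousOn
      exact ⟨f x₀, hf _ ⟨hx₀, hx₀.1⟩, fun x hx => hmin hx⟩
  obtain ⟨m, hm, hmin⟩ := key
  refine ⟨m⁻¹ • (f : (Fin d → ℝ) →ₗ[ℝ] ℝ), fun x hx => ?_⟩
  rcases eq_or_ne x 0 with rfl | hx0
  · simp
  have hxn : 0 < ‖x‖ := norm_pos_iff.2 hx0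
  have := hmin (‖x‖⁻¹ • x) ⟨hK.smul_mem _ (by positivity) x hx, by simp [norm_smul, hx0]⟩
  rw [map_smul, smul_eq_mul, inv_mul_eq_div, le_div_iff₀ hxn] at this
  change ‖x‖ ≤ m⁻¹ * f x
  rw [inv_mul_eq_div, le_div_iff₀ hm]
  linarith

/-! ### Spectral radius below 1 and decay of matrix powers -/

section Spectral

attribute [local instance] Matrix.linftyOpNormedRing Matrix.linftyOpNormedAlgebra

variable {n : Type*} [Fintype n] [DecidableEq n]

theorem norm_entry_le_linfty_opNorm (A : Matrix n n ℂ) (i j : n) : ‖A i j‖ ≤ ‖A‖ := by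
  rw [Matrix.linfty_opNorm_def, ← coe_nnnorm, NNReal.coe_le_coe]
  exact (Finset.single_le_sum (f := fun j => ‖A i j‖₊) (fun _ _ => zero_le)
    (Finset.mem_univ j)).trans
    (Finset.le_sup (f := fun i => ∑ j, ‖A i j‖₊) (Finset.mem_univ i))

theorem linfty_opNorm_le_sum (A : Matrix n n ℂ) : ‖A‖ ≤ ∑ i, ∑ j, ‖A i j‖ := by
  rw [Matrix.linfty_opNorm_def]
  have : (Finset.univ.sup fun i => ∑ j, ‖A i j‖₊) ≤ ∑ i, ∑ j, ‖A i j‖₊ :=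
    Finset.sup_le fun i _ => Finset.single_le_sum (f := fun i => ∑ j, ‖A i j‖₊)
      (fun _ _ => zero_le) (Finset.mem_univ i)
  simpa using NNReal.coe_le_coe.2 this

/-- Gelfand's formula, with a rate chosen strictly between the spectral radius and 1. -/
theorem expDecay_of_specRadius_lt_one {T : Matrix n n ℝ} (h : specRadius T < 1) (i j : n) :
    ExpDecay fun k => |(T ^ k) i j| := by
  set A := T.map (algebraMap ℝ ℂ) with hA
  have hpow : ∀ k, A ^ k = (T ^ k).map (algebraMap ℝ ℂ) := fun k => by
    rw [hA, Matrix.map_pow]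
  have hdec : ExpDecay fun k => ‖A ^ k‖ := by
    obtain ⟨r, hr, hr1⟩ := exists_between h
    have hrtop : r ≠ ⊤ := (hr1.trans ENNReal.one_lt_top).ne
    refine expDecay_of_eventually_root_lt (q := 1) (r := r.toReal) (fun k => norm_nonneg _)
      one_pos ?_ ?_
    · simpa using (ENNReal.toReal_lt_toReal hrtop ENNReal.one_ne_top).2 hr1
    · filter_upwards [(spectrum.pow_norm_pow_one_div_tendsto_nhds_spectralRadius A).eventually
        (gt_mem_nhds hr)] with k hk
      rw [one_mul]
      exact (ENNReal.ofReal_lt_iff_lt_toReal (by positivity) hrtop).1 hk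
  refine hdec.mono fun k => ?_
  have := norm_entry_le_linfty_opNorm (A ^ k) i j
  rw [hpow] at this ⊢
  simpa using this

/-- The spectral radius is bounded by a root of `‖A ^ (k + 1)‖ * ‖1‖` for every `k`, so one `k`
making this product less than 1 is enough. -/
theorem specRadius_lt_one_of_expDecay {T : Matrix n n ℝ}
    (h : ∀ i j, ExpDecay fun k => |(T ^ k) i j|) : specRadius T < 1 := by
  set A := T.map (algebraMap ℝ ℂ) with hA
  have hpow : ∀ k, A ^ k = (T ^ k).map (algebraMap ℝ ℂ) := fun k => by
    rw [hA, Matrix.map_pow]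
  obtain ⟨C, hC, β, hβ, H⟩ : ExpDecay fun k => ‖A ^ k‖ :=
    (ExpDecay.sum Finset.univ fun i _ => ExpDecay.sum Finset.univ fun j _ => h i j).mono
      fun k => (linfty_opNorm_le_sum _).trans (by simp [hpow])
  have hlim : Tendsto (fun k : ℕ => C * Real.exp (-β * (k + 1 : ℕ)) * ‖(1 : Matrix n n ℂ)‖) atTop
      (𝓝 (C * 0 * ‖(1 : Matrix n n ℂ)‖)) := by
    refine ((Real.tendsto_exp_atBot.comp ?_).const_mul C).mul_const _
    exact (tendsto_natCast_atTop_atTop.comp (tendsto_add_atTop_nat 1)).const_mul_atTop_of_neg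
      (by linarith)
  rw [mul_zero, zero_mul] at hlim
  obtain ⟨k, hk⟩ := (hlim.eventually (gt_mem_nhds one_pos)).exists
  refine (spectrum.spectralRadius_le_pow_nnnorm_pow_one_div ℂ A k).trans_lt ?_
  have hlt : ‖A ^ (k + 1)‖₊ * ‖(1 : Matrix n n ℂ)‖₊ < 1 := by
    have : ‖A ^ (k + 1)‖ * ‖(1 : Matrix n n ℂ)‖ < 1 :=
      (mul_le_mul_of_nonneg_right (H _) (norm_nonneg _)).trans_lt hk
    exact_mod_cast this
  rw [← ENNReal.mul_rpow_of_nonneg _ _ (by positivity)]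
  exact ENNReal.rpow_lt_one (by exact_mod_cast hlt) (by positivity)

end Spectral

/-! ### Orbits of a vector under a matrix -/

theorem exists_norm_mulVec_le {m n : Type*} [Fintype m] [Fintype n] (A : Matrix m n ℝ) :
    ∃ C ≥ (0 : ℝ), ∀ y, ‖A *ᵥ y‖ ≤ C * ‖y‖ :=
  ⟨‖A.mulVecLin.toContinuousLinearMap‖, norm_nonneg _, A.mulVecLin.toContinuousLinearMap.le_opNorm⟩

/-- The norm along the orbit of a vector under a matrix is submultiplicative up to a constant. -/
theorem exists_norm_orbit_submul {n : Type*} [Fintype n] [DecidableEq n] (T : Matrix n n ℝ)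
    (v : n → ℝ) :
    ∃ D ≥ (0 : ℝ), ∀ k l, ‖(T ^ (k + l)) *ᵥ v‖ ≤ D * ‖(T ^ k) *ᵥ v‖ * ‖(T ^ l) *ᵥ v‖ := by
  -- By Cayley–Hamilton, every `T ^ k *ᵥ v` is a combination of the first `m` points of the orbit.
  set m := T.charpoly.natDegree + 1
  let φ : (Fin m → ℝ) →ₗ[ℝ] (n → ℝ) :=
    Fintype.linearCombination ℝ fun i : Fin m => (T ^ (i : ℕ)) *ᵥ v
  have hφ : ∀ c, φ c = ∑ i : Fin m, c i • ((T ^ (i : ℕ)) *ᵥ v) := fun c => rfl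
  have hmem : ∀ k, (T ^ k) *ᵥ v ∈ LinearMap.range φ := by
    intro k
    refine ⟨fun i => (Polynomial.X ^ k %ₘ T.charpoly).coeff i, ?_⟩
    rw [hφ, Matrix.pow_eq_aeval_mod_charpoly T k, Polynomial.aeval_eq_sum_range' (n := m),
      Matrix.sum_mulVec, Fin.sum_univ_eq_sum_range
        (fun i => (Polynomial.X ^ k %ₘ T.charpoly).coeff i • ((T ^ i) *ᵥ v))]
    · simp only [Matrix.smul_mulVec]
    · exact Nat.lt_succ_of_le (Polynomial.natDegree_modByMonic_le _ T.charpoly_monic)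
  -- A linear choice of coefficients is automatically bounded by a constant times `‖T ^ k *ᵥ v‖`.
  obtain ⟨g, hg⟩ := φ.rangeRestrict.exists_rightInverse_of_surjective φ.range_rangeRestrict
  choose c hc0 hc using fun i : Fin m => exists_norm_mulVec_le (T ^ (i : ℕ))
  set G := g.toContinuousLinearMap
  refine ⟨∑ i, ‖G‖ * c i, Finset.sum_nonneg fun i _ => mul_nonneg G.opNorm_nonneg (hc0 i),
    fun k l => ?_⟩
  set y : LinearMap.range φ := ⟨(T ^ k) *ᵥ v, hmem k⟩
  have hy : ∑ i : Fin m, g y i • ((T ^ (i : ℕ)) *ᵥ v) = (T ^ k) *ᵥ v := by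
    have := congrArg Subtype.val (LinearMap.congr_fun hg y)
    simpa [hφ] using this
  -- Powers of `T` commute, so the coefficients that express `T ^ k *ᵥ v` also express its image
  -- under `T ^ l`.
  have hkl : (T ^ (k + l)) *ᵥ v = ∑ i : Fin m, g y i • ((T ^ (i : ℕ)) *ᵥ ((T ^ l) *ᵥ v)) := by
    rw [add_comm, pow_add, ← Matrix.mulVec_mulVec, ← hy, Matrix.mulVec_sum]
    refine Finset.sum_congr rfl fun i _ => ?_
    rw [Matrix.mulVec_smul, Matrix.mulVec_mulVec, Matrix.mulVec_mulVec, ← pow_add, ← pow_add,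
      add_comm]
  rw [hkl, Finset.sum_mul, Finset.sum_mul]
  refine (norm_sum_le _ _).trans (Finset.sum_le_sum fun i _ => ?_)
  have hgi : ‖g y i‖ ≤ ‖G‖ * ‖(T ^ k) *ᵥ v‖ := (norm_le_pi_norm (g y) i).trans (G.le_opNorm y)
  calc ‖g y i • ((T ^ (i : ℕ)) *ᵥ ((T ^ l) *ᵥ v))‖
      ≤ (‖G‖ * ‖(T ^ k) *ᵥ v‖) * (c i * ‖(T ^ l) *ᵥ v‖) := by
        rw [norm_smul]
        gcongr
        exact hc i _
    _ = _ := by ring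

/-! ### Kronecker powers and the entries of the lifted matrix -/

section Tensor

variable {N d : ℕ} (p : ℕ)

theorem kronPow_mulVec_vecKronPow (A : Matrix (Fin d) (Fin d) ℝ) (x : Fin d → ℝ) :
    kronPow p A *ᵥ vecKronPow p x = vecKronPow p (A *ᵥ x) := by
  ext f
  simp only [Matrix.mulVec, dotProduct, kronPow, vecKronPow, Matrix.of_apply,
    ← Finset.prod_mul_distrib]
  rw [Finset.prod_univ_sum, Fintype.piFinset_univ]

theorem kronPow_mul (A B : Matrix (Fin d) (Fin d) ℝ) :
    kronPow p (A * B) = kronPow p A * kronPow p B := by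
  ext f g
  simp only [Matrix.mul_apply, kronPow, Matrix.of_apply, ← Finset.prod_mul_distrib]
  rw [Finset.prod_univ_sum, Fintype.piFinset_univ]

theorem kronPow_one_eq_one : kronPow p (1 : Matrix (Fin d) (Fin d) ℝ) = 1 := by
  ext f g
  by_cases h : f = g
  · subst h
    simp [kronPow]
  · obtain ⟨l, hl⟩ := Function.ne_iff.1 h
    rw [Matrix.one_apply_ne h]
    exact Finset.prod_eq_zero (Finset.mem_univ l) (Matrix.one_apply_ne hl)

theorem norm_vecKronPow_le (x : Fin d → ℝ) : ‖vecKronPow p x‖ ≤ ‖x‖ ^ p := by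
  refine (pi_norm_le_iff_of_nonneg (by positivity)).2 fun f => ?_
  rw [vecKronPow, norm_prod]
  exact (Finset.prod_le_prod (fun _ _ => norm_nonneg _) fun l _ => norm_le_pi_norm x (f l)).trans
    (by simp)

theorem liftedMatrix_apply (P : Matrix (Fin N) (Fin N) ℝ) (M : Fin N → Matrix (Fin d) (Fin d) ℝ)
    (a b : Fin N × (Fin p → Fin d)) :
    liftedMatrix p P M a b = P b.1 a.1 * kronPow p (M b.1) a.2 b.2 := by
  obtain ⟨j, f⟩ := a
  obtain ⟨i, g⟩ := b
  simp [liftedMatrix, Matrix.mul_apply, Fintype.sum_prod_type, Matrix.one_apply,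
    Matrix.blockDiagonal_apply, Matrix.kroneckerMap_apply]

end Tensor

/-! ### Matrix norms against entries, Kronecker powers and vectors -/

section Norms

variable {d : ℕ}

theorem IsNorm.exists_abs_entry_le {nMat : Seminorm ℝ (Matrix (Fin d) (Fin d) ℝ)}
    (h : IsNorm nMat) : ∃ C > (0 : ℝ), ∀ A i j, |A i j| ≤ C * nMat A := by
  let _ : NormedAddCommGroup (Matrix (Fin d) (Fin d) ℝ) := Matrix.normedAddCommGroup
  let _ : NormedSpace ℝ (Matrix (Fin d) (Fin d) ℝ) := Matrix.normedSpace
  obtain ⟨C, hC, H⟩ := h.exists_norm_le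
  exact ⟨C, hC, fun A i j => (Matrix.norm_entry_le_entrywise_sup_norm A).trans (H A)⟩

theorem exists_seminorm_matrix_le (nMat : Seminorm ℝ (Matrix (Fin d) (Fin d) ℝ)) :
    ∃ C > (0 : ℝ), ∀ A : Matrix (Fin d) (Fin d) ℝ, ∀ r ≥ (0 : ℝ), (∀ i j, |A i j| ≤ r) →
      nMat A ≤ C * r := by
  let _ : NormedAddCommGroup (Matrix (Fin d) (Fin d) ℝ) := Matrix.normedAddCommGroup
  let _ : NormedSpace ℝ (Matrix (Fin d) (Fin d) ℝ) := Matrix.normedSpace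
  obtain ⟨C, hC, H⟩ := exists_seminorm_le nMat
  refine ⟨C, hC, fun A r hr hA => (H A).trans ?_⟩
  gcongr
  exact (Matrix.norm_le_iff hr).2 hA

theorem norm_mulVec_le_of_entry_le {m n : Type*} [Fintype m] [Fintype n] {A : Matrix m n ℝ} {r : ℝ}
    (hr : 0 ≤ r) (hA : ∀ i j, |A i j| ≤ r) (x : n → ℝ) :
    ‖A *ᵥ x‖ ≤ Fintype.card n * r * ‖x‖ := by
  refine (pi_norm_le_iff_of_nonneg (by positivity)).2 fun i => ?_
  calc ‖(A *ᵥ x) i‖ ≤ ∑ j, ‖A i j * x j‖ := norm_sum_le _ _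
    _ ≤ ∑ _j : n, r * ‖x‖ := by
        refine Finset.sum_le_sum fun j _ => ?_
        rw [norm_mul]
        gcongr
        · exact hA i j
        · exact norm_le_pi_norm x j
    _ = _ := by simp [mul_assoc]

theorem IsNorm.exists_norm_kronPow_mulVec_le (p : ℕ)
    {nMat : Seminorm ℝ (Matrix (Fin d) (Fin d) ℝ)} (h : IsNorm nMat) :
    ∃ C ≥ (0 : ℝ), ∀ A y, ‖kronPow p A *ᵥ y‖ ≤ C * nMat A ^ p * ‖y‖ := by
  obtain ⟨C, hC, H⟩ := h.exists_abs_entry_le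
  refine ⟨Fintype.card (Fin p → Fin d) * C ^ p, by positivity, fun A y => ?_⟩
  have hA : 0 ≤ nMat A := apply_nonneg _ _
  refine (norm_mulVec_le_of_entry_le (r := (C * nMat A) ^ p) (by positivity) (fun f g => ?_)
    y).trans_eq (by rw [mul_pow]; ring)
  rw [kronPow, Matrix.of_apply, Finset.abs_prod]
  exact (Finset.prod_le_prod (fun _ _ => abs_nonneg _) fun l _ => H A (f l) (g l)).trans (by simp)

theorem IsNorm.exists_mulVec_le {nMat : Seminorm ℝ (Matrix (Fin d) (Fin d) ℝ)} (h : IsNorm nMat)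
    {nVec : Seminorm ℝ (Fin d → ℝ)} (hVec : IsNorm nVec) :
    ∃ C ≥ (0 : ℝ), ∀ A x, nVec (A *ᵥ x) ≤ C * nMat A * nVec x := by
  obtain ⟨C, hC, H⟩ := h.exists_abs_entry_le
  obtain ⟨C₁, hC₁, H₁⟩ := hVec.exists_norm_le
  obtain ⟨C₂, hC₂, H₂⟩ := exists_seminorm_le nVec
  refine ⟨C₂ * (Fintype.card (Fin d) * C * C₁), by positivity, fun A x => ?_⟩
  have hA : 0 ≤ nMat A := apply_nonneg _ _
  calc nVec (A *ᵥ x) ≤ C₂ * ‖A *ᵥ x‖ := H₂ _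
    _ ≤ C₂ * (Fintype.card (Fin d) * (C * nMat A) * (C₁ * nVec x)) := by
        gcongr
        refine (norm_mulVec_le_of_entry_le (by positivity) (H A) x).trans ?_
        gcongr
        exact H₁ x
    _ = _ := by ring

end Norms

/-! ### Trajectories as products of matrices -/

section Products

variable {N d : ℕ} (M : Fin N → Matrix (Fin d) (Fin d) ℝ)

/-- The switching sequence delayed by one step. -/
def delay (i : ℕ → Fin N) : ℕ → Fin N := fun l => i (l - 1)

theorem dependsOn_matProd (k : ℕ) : DependsOn (fun i => matProd M i k) (Set.Iic k) := by
  induction k with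
  | zero => exact fun _ _ _ => rfl
  | succ k ih =>
    intro i j h
    have h1 : matProd M i k = matProd M j k := ih fun l hl => h l (Nat.le_succ_of_le hl)
    change M (i (k + 1)) * matProd M i k = M (j (k + 1)) * matProd M j k
    rw [h1, h (k + 1) (Set.mem_Iic.2 le_rfl)]

theorem dependsOn_matProd_delay (k : ℕ) :
    DependsOn (fun i => matProd M (delay i) k) (Set.Iic k) := fun _ _ h =>
  dependsOn_matProd M k fun l hl => h (l - 1) ((Nat.sub_le l 1).trans hl)

/-- A trajectory uses `A_{k-1} ⋯ A_0`, while `matProd` is `A_k ⋯ A_1`; delaying the sequence aligns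
them. The truncated value of `delay` at 0 is never read. -/
theorem traj_eq_matProd_delay (i : ℕ → Fin N) (x : Fin d → ℝ) (k : ℕ) :
    traj M i x k = matProd M (delay i) k *ᵥ x := by
  induction k with
  | zero => simp [traj, matProd]
  | succ k ih => rw [traj, ih, matProd, Matrix.mulVec_mulVec]; rfl

theorem matProd_delay_succ (i : ℕ → Fin N) (k : ℕ) :
    matProd M (delay i) (k + 1) = matProd M i k * M (i 0) := by
  induction k with
  | zero => simp [matProd, delay]
  | succ k ih => rw [matProd, ih, matProd, Matrix.mul_assoc]; rfl

end Products

/-! ### The Markov property for functions of finitely many states -/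

section Markov

variable {N : ℕ} {P : Matrix (Fin N) (Fin N) ℝ} {s : Fin N} {Ω : Type*} [MeasurableSpace Ω]
  {μ : Measure Ω} {σ : ℕ → Ω → Fin N} {E : Type*} [NormedAddCommGroup E]

/-- The sequence that follows `i` and then stays at its last value. -/
def extendPath {k : ℕ} (i : Fin (k + 1) → Fin N) : ℕ → Fin N := fun l => i ⟨min l k, by omega⟩

/-- The event that the first `k + 1` states are those of `i`. -/
def cylinder (σ : ℕ → Ω → Fin N) {k : ℕ} (i : Fin (k + 1) → Fin N) : Set Ω :=
  {ω | ∀ l ≤ k, σ l ω = extendPath i l}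

theorem IsMarkovChain.measurableSet_state (hσ : IsMarkovChain P s μ σ) (k : ℕ) (j : Fin N) :
    MeasurableSet {ω | σ k ω = j} :=
  hσ.measurable k (measurableSet_singleton j)

theorem IsMarkovChain.measurableSet_cylinder (hσ : IsMarkovChain P s μ σ) {k : ℕ}
    (i : Fin (k + 1) → Fin N) : MeasurableSet (cylinder σ i) := by
  have : cylinder σ i = ⋂ l ∈ Set.Iic k, {ω | σ l ω = extendPath i l} := by
    ext ω
    simp [cylinder]
  rw [this]
  exact MeasurableSet.biInter (Set.to_countable _) fun l _ => hσ.measurableSet_state l _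

/-- Each `ω` lies in exactly one cylinder of given length. Functions of finitely many states thus
become finite sums, for which integrability and integrals are elementary. -/
theorem sum_indicator_cylinder {Ω : Type*} {σ : ℕ → Ω → Fin N} {k : ℕ} {g : (ℕ → Fin N) → E} (hg : DependsOn g (Set.Iic k))
    (ω : Ω) :
    ∑ i : Fin (k + 1) → Fin N, (cylinder σ i).indicator (fun _ => g (extendPath i)) ω =
      g fun l => σ l ω := by
  set i₀ : Fin (k + 1) → Fin N := fun l => σ l ω
  have hext : ∀ l ≤ k, extendPath i₀ l = σ l ω := fun l hl => by simp [extendPath, i₀, hl]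
  rw [Finset.sum_eq_single i₀]
  · rw [Set.indicator_of_mem (show ω ∈ cylinder σ i₀ from fun l hl => (hext l hl).symm)]
    exact hg fun l hl => hext l hl
  · intro i _ hi
    refine Set.indicator_of_notMem (fun h => hi (funext fun l => ?_)) _
    have := h l (Nat.lt_succ_iff.1 l.2)
    simpa [extendPath, Nat.lt_succ_iff.1 l.2, i₀] using this.symm
  · simp

variable [IsProbabilityMeasure μ]

theorem IsMarkovChain.integrable_comp (hσ : IsMarkovChain P s μ σ) {k : ℕ}
    {g : (ℕ → Fin N) → E} (hg : DependsOn g (Set.Iic k)) :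
    Integrable (fun ω => g fun l => σ l ω) μ := by
  simp_rw [← sum_indicator_cylinder hg]
  exact integrable_finsetSum _ fun i _ =>
    (integrable_const _).indicator (hσ.measurableSet_cylinder i)

variable [NormedSpace ℝ E] [CompleteSpace E]

theorem IsMarkovChain.integral_indicator_eq_sum (hσ : IsMarkovChain P s μ σ)
    {k : ℕ} {g : (ℕ → Fin N) → E} (hg : DependsOn g (Set.Iic k)) {B : Set Ω}
    (hB : MeasurableSet B) :
    ∫ ω, B.indicator (fun ω => g fun l => σ l ω) ω ∂μ =
      ∑ i : Fin (k + 1) → Fin N, μ.real (cylinder σ i ∩ B) • g (extendPath i) := by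
  rw [integral_indicator hB]
  simp_rw [← sum_indicator_cylinder hg]
  rw [integral_finsetSum _ fun i _ =>
    (integrable_const _).indicator (hσ.measurableSet_cylinder i)]
  refine Finset.sum_congr rfl fun i _ => ?_
  rw [integral_indicator_const _ (hσ.measurableSet_cylinder i),
    measureReal_restrict_apply (hσ.measurableSet_cylinder i)]

/-- The transition law multiplied out, so that it also holds, trivially, on null cylinders where
conditioning says nothing. -/
theorem IsMarkovChain.measureReal_cylinder_inter (hσ : IsMarkovChain P s μ σ)
    (hP : ∀ i j, 0 ≤ P i j) {k : ℕ} (i : Fin (k + 1) → Fin N) (j : Fin N) :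
    μ.real (cylinder σ i ∩ {ω | σ (k + 1) ω = j}) =
      μ.real (cylinder σ i) * P (extendPath i k) j := by
  by_cases h : μ (cylinder σ i) = 0
  · rw [measureReal_def, measureReal_def, h, measure_mono_null Set.inter_subset_left h]
    simp
  · have := hσ.transition k (extendPath i) j h
    change ProbabilityTheory.cond μ (cylinder σ i) _ = _ at this
    rw [ProbabilityTheory.cond_apply (hσ.measurableSet_cylinder i)] at this
    rw [measureReal_def, measureReal_def, ← ENNReal.toReal_ofReal (hP (extendPath i k) j),
      ← ENNReal.toReal_mul, ← this, ← mul_assoc, ENNReal.mul_inv_cancel h (measure_ne_top _ _),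
      one_mul]

/-- The Markov property in integrated form. -/
theorem IsMarkovChain.integral_indicator_succ (hσ : IsMarkovChain P s μ σ)
    (hP : ∀ i j, 0 ≤ P i j) {k : ℕ} {g : (ℕ → Fin N) → E} (hg : DependsOn g (Set.Iic k))
    (j : Fin N) :
    ∫ ω, {ω | σ (k + 1) ω = j}.indicator (fun ω => g fun l => σ l ω) ω ∂μ =
      ∑ i, P i j • ∫ ω, {ω | σ k ω = i}.indicator (fun ω => g fun l => σ l ω) ω ∂μ := by
  -- The sum over cylinders, with weights `P (i k) j`, is recognised as the integral of `P (σ k) j •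
  -- g`, which is then split by the value of `σ k`.
  have hg' : DependsOn (fun i => P (i k) j • g i) (Set.Iic k) := fun i i' h => by
    simp only [h k (Set.mem_Iic.2 le_rfl), hg h]
  have h1 := hσ.integral_indicator_eq_sum hg' MeasurableSet.univ
  rw [hσ.integral_indicator_eq_sum hg (hσ.measurableSet_state (k + 1) j)]
  simp only [hσ.measureReal_cylinder_inter hP]
  simp only [Set.indicator_univ, Set.inter_univ, smul_smul] at h1
  rw [← h1]
  simp_rw [← integral_smul]
  rw [← integral_finsetSum]
  · refine integral_congr_ae (ae_of_all _ fun ω => ?_)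
    simp only
    rw [Finset.sum_eq_single (σ k ω)]
    · simp
    · intro i _ hi
      simp [hi.symm]
    · simp
  · exact fun i _ => (((hσ.integrable_comp hg).indicator (hσ.measurableSet_state k i))).smul _

end Markov

/-! ### Linear evolution of the state-wise tensor means -/

section Lift

variable {N d : ℕ} {p : ℕ} {P : Matrix (Fin N) (Fin N) ℝ} {s : Fin N} {Ω : Type*}
  [MeasurableSpace Ω] {μ : Measure Ω} [IsProbabilityMeasure μ] {σ : ℕ → Ω → Fin N}
  {M : Fin N → Matrix (Fin d) (Fin d) ℝ} {r : ℕ}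
  {Q : ℕ → (ℕ → Fin N) → Matrix (Fin d) (Fin d) ℝ}

/-- A matrix product process `Q` adapted, with lag `r`, to the switching sequence. -/
structure IsProductProcess (M : Fin N → Matrix (Fin d) (Fin d) ℝ) (r : ℕ)
    (Q : ℕ → (ℕ → Fin N) → Matrix (Fin d) (Fin d) ℝ) : Prop where
  zero : ∀ i, Q 0 i = 1
  succ : ∀ k i, Q (k + 1) i = M (i (k + r)) * Q k i
  dependsOn : ∀ k, DependsOn (Q k) (Set.Iic (k + r))

/-- The lag is 1 because the first factor is `A_1`; for the delayed products, which start with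
`A_0`, it is 0. -/
theorem isProductProcess_matProd (M : Fin N → Matrix (Fin d) (Fin d) ℝ) :
    IsProductProcess M 1 fun k i => matProd M i k where
  zero _ := rfl
  succ _ _ := rfl
  dependsOn k _ _ h := dependsOn_matProd M k fun l hl => h l (Nat.le_succ_of_le hl)

theorem isProductProcess_matProd_delay (M : Fin N → Matrix (Fin d) (Fin d) ℝ) :
    IsProductProcess M 0 fun k i => matProd M (delay i) k where
  zero _ := rfl
  succ _ _ := rfl
  dependsOn k := dependsOn_matProd_delay M k

/-- The tensor process `Q_k^{⊗p} y`, averaged separately on each event `σ (k + r) = j`. -/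
noncomputable def liftedMean (p r : ℕ) (Q : ℕ → (ℕ → Fin N) → Matrix (Fin d) (Fin d) ℝ) (μ : Measure Ω)
    (σ : ℕ → Ω → Fin N) (y : (Fin p → Fin d) → ℝ) (k : ℕ) : Fin N × (Fin p → Fin d) → ℝ :=
  fun a => (∫ ω, {ω | σ (k + r) ω = a.1}.indicator
    (fun ω => kronPow p (Q k fun l => σ l ω) *ᵥ y) ω ∂μ) a.2

theorem IsProductProcess.dependsOn_kronPow (hQ : IsProductProcess M r Q) (k : ℕ)
    (y : (Fin p → Fin d) → ℝ) :
    DependsOn (fun i => kronPow p (Q k i) *ᵥ y) (Set.Iic (k + r)) := fun i j h => by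
  simp only [hQ.dependsOn k h]

theorem IsProductProcess.dependsOn_seminorm_pow (hQ : IsProductProcess M r Q) (k : ℕ)
    (n : Seminorm ℝ (Matrix (Fin d) (Fin d) ℝ)) :
    DependsOn (fun i => n (Q k i) ^ p) (Set.Iic (k + r)) := fun i j h => by
  simp only [hQ.dependsOn k h]

/-- On the event `σ (k + r) = i` the new factor is the constant matrix `M i`, which leaves the
integral; the Markov property then redistributes mass from `i` to `j` with weight `P i j`. -/
theorem liftedMean_succ (hσ : IsMarkovChain P s μ σ) (hP : ∀ i j, 0 ≤ P i j)
    (hQ : IsProductProcess M r Q) (y : (Fin p → Fin d) → ℝ) (k : ℕ) :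
    liftedMean p r Q μ σ y (k + 1) = liftedMatrix p P M *ᵥ liftedMean p r Q μ σ y k := by
  -- `Q (k + 1)` is determined by time `k + r`, one step before the state defining the next event,
  -- as the Markov property requires.
  have hdep : DependsOn (fun i => kronPow p (Q (k + 1) i) *ᵥ y) (Set.Iic (k + r)) :=
    fun i j h => by
      simp only [hQ.succ, hQ.dependsOn k h, h (k + r) (Set.mem_Iic.2 le_rfl)]
  ext ⟨j, f⟩
  have key : ∀ i, ∫ ω, {ω | σ (k + r) ω = i}.indicator
      (fun ω => kronPow p (Q (k + 1) fun l => σ l ω) *ᵥ y) ω ∂μ =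
      kronPow p (M i) *ᵥ ∫ ω, {ω | σ (k + r) ω = i}.indicator
        (fun ω => kronPow p (Q k fun l => σ l ω) *ᵥ y) ω ∂μ := by
    intro i
    have h := (kronPow p (M i)).mulVecLin.toContinuousLinearMap.integral_comp_comm
      ((hσ.integrable_comp (hQ.dependsOn_kronPow k y)).indicator
        (hσ.measurableSet_state (k + r) i))
    refine Eq.trans ?_ h
    refine integral_congr_ae (ae_of_all _ fun ω => ?_)
    by_cases hω : σ (k + r) ω = i
    · simp [hω, hQ.succ, kronPow_mul]
    · simp [hω]
  have h := hσ.integral_indicator_succ hP hdep j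
  simp only [key] at h
  rw [liftedMean, Nat.add_right_comm, h]
  simp only [Matrix.mulVec, dotProduct, liftedMatrix_apply, Fintype.sum_prod_type, liftedMean,
    Finset.sum_apply, Pi.smul_apply, smul_eq_mul, Finset.mul_sum, mul_assoc]

theorem liftedMean_eq_pow_mulVec (hσ : IsMarkovChain P s μ σ) (hP : ∀ i j, 0 ≤ P i j)
    (hQ : IsProductProcess M r Q) (y : (Fin p → Fin d) → ℝ) (k : ℕ) :
    liftedMean p r Q μ σ y k = (liftedMatrix p P M ^ k) *ᵥ liftedMean p r Q μ σ y 0 := by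
  induction k with
  | zero => simp
  | succ k ih => rw [liftedMean_succ hσ hP hQ, ih, Matrix.mulVec_mulVec, pow_succ']

theorem norm_liftedMean_le (hσ : IsMarkovChain P s μ σ) (hQ : IsProductProcess M r Q)
    {nMat : Seminorm ℝ (Matrix (Fin d) (Fin d) ℝ)} {C : ℝ} (hC0 : 0 ≤ C)
    (hC : ∀ A y, ‖kronPow p A *ᵥ y‖ ≤ C * nMat A ^ p * ‖y‖) (y : (Fin p → Fin d) → ℝ) (k : ℕ) :
    ‖liftedMean p r Q μ σ y k‖ ≤ C * ‖y‖ * ∫ ω, nMat (Q k fun l => σ l ω) ^ p ∂μ := by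
  have h0 : 0 ≤ ∫ ω, nMat (Q k fun l => σ l ω) ^ p ∂μ :=
    integral_nonneg fun ω => pow_nonneg (apply_nonneg _ _) _
  refine (pi_norm_le_iff_of_nonneg (by positivity)).2 fun a => ?_
  refine (norm_le_pi_norm _ a.2).trans ?_
  rw [← integral_const_mul]
  refine norm_integral_le_of_norm_le
    ((hσ.integrable_comp (hQ.dependsOn_seminorm_pow k nMat)).const_mul _)
    (ae_of_all _ fun ω => ?_)
  refine (norm_indicator_le_norm_self _ _).trans ((hC _ _).trans_eq (by ring))

theorem integral_kronPow_eq_sum_liftedMean (hσ : IsMarkovChain P s μ σ)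
    (hQ : IsProductProcess M r Q) (y : (Fin p → Fin d) → ℝ) (k : ℕ) :
    ∫ ω, kronPow p (Q k fun l => σ l ω) *ᵥ y ∂μ =
      fun f => ∑ j, liftedMean p r Q μ σ y k (j, f) := by
  have hint := hσ.integrable_comp (hQ.dependsOn_kronPow k y)
  have : ∀ ω, kronPow p (Q k fun l => σ l ω) *ᵥ y =
      ∑ j, {ω | σ (k + r) ω = j}.indicator
        (fun ω => kronPow p (Q k fun l => σ l ω) *ᵥ y) ω := by
    intro ω
    rw [Finset.sum_eq_single (σ (k + r) ω)]
    · simp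
    · intro i _ hi
      simp [hi.symm]
    · simp
  rw [integral_congr_ae (ae_of_all _ this), integral_finsetSum _ fun j _ =>
    hint.indicator (hσ.measurableSet_state (k + r) j)]
  ext f
  simp [liftedMean]

theorem norm_integral_kronPow_le (hσ : IsMarkovChain P s μ σ)
    (hQ : IsProductProcess M r Q) (y : (Fin p → Fin d) → ℝ) (k : ℕ) :
    ‖∫ ω, kronPow p (Q k fun l => σ l ω) *ᵥ y ∂μ‖ ≤ N * ‖liftedMean p r Q μ σ y k‖ := by
  rw [integral_kronPow_eq_sum_liftedMean hσ hQ]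
  refine (pi_norm_le_iff_of_nonneg (by positivity)).2 fun f => ?_
  calc _ ≤ ∑ j, ‖liftedMean p r Q μ σ y k (j, f)‖ := norm_sum_le _ _
    _ ≤ ∑ _j : Fin N, ‖liftedMean p r Q μ σ y k‖ :=
        Finset.sum_le_sum fun j _ => norm_le_pi_norm _ _
    _ = _ := by simp

/-- With lag 0 the mass at time 0 sits in block `s`, so standard basis vectors lift to standard
basis vectors. This gives access to the columns `(s, g)` of the powers of the lifted matrix. -/
theorem liftedMean_zero_single (hσ : IsMarkovChain P s μ σ) (hQ : IsProductProcess M 0 Q)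
    (g : Fin p → Fin d) :
    liftedMean p 0 Q μ σ (Pi.single g 1) 0 = Pi.single (s, g) 1 := by
  ext ⟨j, f⟩
  have : ∫ ω, {ω | σ 0 ω = j}.indicator
      (fun ω => kronPow p (Q 0 fun l => σ l ω) *ᵥ (Pi.single g 1 : (Fin p → Fin d) → ℝ)) ω ∂μ =
      if s = j then Pi.single g 1 else 0 := by
    have h : ∀ᵐ ω ∂μ, {ω | σ 0 ω = j}.indicator
        (fun ω => kronPow p (Q 0 fun l => σ l ω) *ᵥ (Pi.single g 1 : (Fin p → Fin d) → ℝ)) ω =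
        if s = j then Pi.single g 1 else 0 := by
      filter_upwards [hσ.initial] with ω hω
      simp only [hQ.zero, kronPow_one_eq_one, Matrix.one_mulVec, Set.indicator_apply,
        Set.mem_ofPred_eq, hω]
    rw [integral_congr_ae h]
    simp
  simp only [liftedMean, this]
  by_cases h : s = j
  · subst h
    by_cases hf : f = g
    · subst hf; simp
    · simp [hf]
  · simp [h, Ne.symm h]

end Lift

/-! ### Bounding norms of products by a linear functional -/

section Domination

variable {N d : ℕ}

/-- The `p`th powers of the norms of the products are dominated by a linear functional of their
Kronecker powers, evaluated at a sum of decomposable tensors. -/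
def IsDominated (p : ℕ) (M : Fin N → Matrix (Fin d) (Fin d) ℝ)
    (nMat : Seminorm ℝ (Matrix (Fin d) (Fin d) ℝ)) (f : ((Fin p → Fin d) → ℝ) →ₗ[ℝ] ℝ)
    {m : ℕ} (e : Fin m → Fin d → ℝ) (D : ℝ) : Prop :=
  ∀ i k, nMat (matProd M i k) ^ p ≤ D * f (kronPow p (matProd M i k) *ᵥ ∑ a, vecKronPow p (e a))

/-- Take `w = ∑ e_b ⊗ e_b` and let `f` be the contraction of the two tensor slots: `f (A^{⊗2} w)` is
the sum of the squared entries of `A`. -/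
theorem exists_isDominated_two (M : Fin N → Matrix (Fin d) (Fin d) ℝ)
    (nMat : Seminorm ℝ (Matrix (Fin d) (Fin d) ℝ)) :
    ∃ (f : ((Fin 2 → Fin d) → ℝ) →ₗ[ℝ] ℝ) (m : ℕ) (e : Fin m → Fin d → ℝ) (D : ℝ),
      0 ≤ D ∧ IsDominated 2 M nMat f e D := by
  obtain ⟨C, hC, H⟩ := exists_seminorm_matrix_le nMat
  refine ⟨∑ a : Fin d, LinearMap.proj fun _ => a, d, fun i => Pi.single i 1, C ^ 2,
    by positivity, fun i k => ?_⟩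
  set A := matProd M i k
  have hf : (∑ a : Fin d, (LinearMap.proj fun _ => a : ((Fin 2 → Fin d) → ℝ) →ₗ[ℝ] ℝ))
      (kronPow 2 A *ᵥ ∑ b, vecKronPow 2 (Pi.single b 1 : Fin d → ℝ)) = ∑ b, ∑ a, A a b ^ 2 := by
    rw [Matrix.mulVec_sum, map_sum]
    simp only [kronPow_mulVec_vecKronPow]
    simp [vecKronPow, LinearMap.sum_apply]
  rw [hf]
  have h0 : 0 ≤ ∑ b, ∑ a, A a b ^ 2 := by positivity
  have hle : nMat A ≤ C * Real.sqrt (∑ b, ∑ a, A a b ^ 2) := by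
    refine H A _ (Real.sqrt_nonneg _) fun a b => Real.abs_le_sqrt ?_
    calc A a b ^ 2 ≤ ∑ a, A a b ^ 2 :=
          Finset.single_le_sum (f := fun a => A a b ^ 2) (fun _ _ => sq_nonneg _)
            (Finset.mem_univ a)
      _ ≤ _ := Finset.single_le_sum (f := fun b => ∑ a, A a b ^ 2) (fun _ _ => by positivity)
            (Finset.mem_univ b)
  calc nMat A ^ 2 ≤ (C * Real.sqrt (∑ b, ∑ a, A a b ^ 2)) ^ 2 := by
        gcongr
    _ = _ := by rw [mul_pow, Real.sq_sqrt h0]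

theorem matProd_mulVec_mem {M : Fin N → Matrix (Fin d) (Fin d) ℝ} {K : Set (Fin d → ℝ)}
    (hM : LeavesInvariant M K) (i : ℕ → Fin N) (k : ℕ) {x : Fin d → ℝ} (hx : x ∈ K) :
    matProd M i k *ᵥ x ∈ K := by
  induction k with
  | zero => simpa [matProd] using hx
  | succ k ih =>
    rw [matProd, ← Matrix.mulVec_mulVec]
    exact hM _ _ ih

/-- Let `e` be interior to `K` and `f` dominate the norm on `K`. For small `x` both `e ± x` lie in
`K`, hence so do their images under `A`, and `2‖Ax‖ ≤ f(A(e + x)) + f(A(e - x)) = 2 f(Ae)`. -/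
theorem exists_isDominated_one {M : Fin N → Matrix (Fin d) (Fin d) ℝ} {K : Set (Fin d → ℝ)}
    (hK : IsProperCone K) (hM : LeavesInvariant M K)
    (nMat : Seminorm ℝ (Matrix (Fin d) (Fin d) ℝ)) :
    ∃ (f : ((Fin 1 → Fin d) → ℝ) →ₗ[ℝ] ℝ) (m : ℕ) (e : Fin m → Fin d → ℝ) (D : ℝ),
      0 ≤ D ∧ IsDominated 1 M nMat f e D := by
  obtain ⟨C, hC, H⟩ := exists_seminorm_matrix_le nMat
  obtain ⟨f, hf⟩ := hK.exists_functional
  obtain ⟨e, he⟩ := hK.solid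
  obtain ⟨ε, hε, hball⟩ := Metric.mem_nhds_iff.1 (mem_interior_iff_mem_nhds.1 he)
  set δ := ε / 2
  have hδ : 0 < δ := half_pos hε
  have hδε : δ < ε := half_lt_self hε
  refine ⟨f ∘ₗ LinearMap.funLeft ℝ ℝ fun a _ => a, 1, fun _ => e, C * δ⁻¹, by positivity,
    fun i k => ?_⟩
  set A := matProd M i k
  have hval : (f ∘ₗ LinearMap.funLeft ℝ ℝ fun a (_ : Fin 1) => a)
      (kronPow 1 A *ᵥ ∑ _a : Fin 1, vecKronPow 1 e) = f (A *ᵥ e) := by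
    simp only [Finset.univ_unique, Finset.sum_singleton, kronPow_mulVec_vecKronPow,
      LinearMap.comp_apply]
    congr 1
    ext a
    simp [LinearMap.funLeft_apply, vecKronPow]
  rw [hval, pow_one]
  have hAe : 0 ≤ f (A *ᵥ e) := (norm_nonneg _).trans
    (hf _ (matProd_mulVec_mem hM i k (interior_subset he)))
  have hx : ∀ x : Fin d → ℝ, ‖x‖ ≤ δ → ‖A *ᵥ x‖ ≤ f (A *ᵥ e) := by
    intro x hx
    have hadd : e + x ∈ K := hball (by simpa [dist_eq_norm] using hx.trans_lt hδε)
    have hsub : e - x ∈ K := hball (by simpa [dist_eq_norm] using hx.trans_lt hδε)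
    have h1 := hf _ (matProd_mulVec_mem hM i k hadd)
    have h2 := hf _ (matProd_mulVec_mem hM i k hsub)
    change ‖A *ᵥ (e + x)‖ ≤ f (A *ᵥ (e + x)) at h1
    change ‖A *ᵥ (e - x)‖ ≤ f (A *ᵥ (e - x)) at h2
    have h3 : (2 : ℝ) • (A *ᵥ x) = A *ᵥ (e + x) - A *ᵥ (e - x) := by
      rw [Matrix.mulVec_add, Matrix.mulVec_sub, two_smul]
      abel
    have h4 : f (A *ᵥ (e + x)) + f (A *ᵥ (e - x)) = 2 * f (A *ᵥ e) := by
      rw [Matrix.mulVec_add, Matrix.mulVec_sub, map_add, map_sub]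
      ring
    have h5 := norm_sub_le (A *ᵥ (e + x)) (A *ᵥ (e - x))
    rw [← h3, norm_smul, Real.norm_eq_abs, abs_two] at h5
    linarith
  rw [mul_assoc]
  -- The entries of column `b` are read off from the bound at `x = δ e_b`, whence the factor `δ⁻¹`.
  refine H A _ (by positivity) fun a b => ?_
  have hs : ‖(Pi.single b δ : Fin d → ℝ)‖ ≤ δ := by
    rw [Pi.norm_single, Real.norm_eq_abs, abs_of_pos hδ]
  have h := (norm_le_pi_norm _ a).trans (hx _ hs)
  rw [Matrix.mulVec_single] at h
  simp only [Pi.smul_apply, Matrix.col_apply, MulOpposite.smul_eq_mul_unop, MulOpposite.unop_op,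
    norm_mul, Real.norm_eq_abs, abs_of_pos hδ] at h
  rw [inv_mul_eq_div, le_div_iff₀ hδ]
  exact h

end Domination

theorem exists_functional_le_norm {n : Type*} [Fintype n] (f : (n → ℝ) →ₗ[ℝ] ℝ) :
    ∃ C ≥ (0 : ℝ), ∀ x, f x ≤ C * ‖x‖ :=
  ⟨‖f.toContinuousLinearMap‖, norm_nonneg _, fun x =>
    (le_abs_self _).trans (f.toContinuousLinearMap.le_opNorm x)⟩

/-! ### Mean product norms and orbits of the lifted matrix -/

section Chain

variable {N d : ℕ} {p : ℕ} {P : Matrix (Fin N) (Fin N) ℝ} {s : Fin N} {Ω : Type*}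
  [MeasurableSpace Ω] {μ : Measure Ω} [IsProbabilityMeasure μ] {σ : ℕ → Ω → Fin N}
  {M : Fin N → Matrix (Fin d) (Fin d) ℝ} {r : ℕ}
  {Q : ℕ → (ℕ → Fin N) → Matrix (Fin d) (Fin d) ℝ}
  {nMat : Seminorm ℝ (Matrix (Fin d) (Fin d) ℝ)} {f : ((Fin p → Fin d) → ℝ) →ₗ[ℝ] ℝ}
  {m : ℕ} {e : Fin m → Fin d → ℝ} {D : ℝ}

theorem integral_pow_le_of_dominated (hσ : IsMarkovChain P s μ σ) (hQ : IsProductProcess M r Q)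
    {w : (Fin p → Fin d) → ℝ} (h : ∀ k i, nMat (Q k i) ^ p ≤ D * f (kronPow p (Q k i) *ᵥ w))
    (k : ℕ) :
    ∫ ω, nMat (Q k fun l => σ l ω) ^ p ∂μ ≤
      D * f (∫ ω, kronPow p (Q k fun l => σ l ω) *ᵥ w ∂μ) := by
  have hint := hσ.integrable_comp (hQ.dependsOn_kronPow k w)
  have hf := f.toContinuousLinearMap.integral_comp_comm hint
  have hfi := f.toContinuousLinearMap.integrable_comp hint
  simp only [LinearMap.coe_toContinuousLinearMap'] at hf hfi
  rw [← hf, ← integral_const_mul]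
  exact integral_mono (hσ.integrable_comp (hQ.dependsOn_seminorm_pow k nMat)) (hfi.const_mul D)
    fun ω => h k _

/-- The mean of the norm of the products is comparable to the norm of an orbit of the lifted
matrix. -/
theorem exists_integral_pow_le_orbit (hσ : IsMarkovChain P s μ σ) (hP : ∀ i j, 0 ≤ P i j)
    (hD0 : 0 ≤ D) (hD : IsDominated p M nMat f e D) (hMat : IsNorm nMat) :
    ∃ (v : Fin N × (Fin p → Fin d) → ℝ) (C₁ C₂ : ℝ), 0 ≤ C₁ ∧ 0 ≤ C₂ ∧
      (∀ k, ∫ ω, nMat (matProd M (fun l => σ l ω) k) ^ p ∂μ ≤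
        C₁ * ‖(liftedMatrix p P M ^ k) *ᵥ v‖) ∧
      ∀ k, ‖(liftedMatrix p P M ^ k) *ᵥ v‖ ≤
        C₂ * ∫ ω, nMat (matProd M (fun l => σ l ω) k) ^ p ∂μ := by
  have hQ := isProductProcess_matProd M
  set w := ∑ a, vecKronPow p (e a)
  obtain ⟨C, hC0, hC⟩ := hMat.exists_norm_kronPow_mulVec_le p
  obtain ⟨F, hF0, hF⟩ := exists_functional_le_norm f
  -- The vector is `w` distributed over the blocks according to the law of `σ 1`.
  refine ⟨liftedMean p 1 (fun k i => matProd M i k) μ σ w 0, D * (F * N), C * ‖w‖,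
    by positivity, by positivity, fun k => ?_, fun k => ?_⟩
  · rw [← liftedMean_eq_pow_mulVec hσ hP hQ]
    calc _ ≤ D * f (∫ ω, kronPow p (matProd M (fun l => σ l ω) k) *ᵥ w ∂μ) :=
          integral_pow_le_of_dominated hσ hQ (fun k i => hD i k) k
      _ ≤ D * (F * (N * ‖liftedMean p 1 (fun k i => matProd M i k) μ σ w k‖)) := by
          gcongr
          refine (hF _).trans ?_
          gcongr
          exact norm_integral_kronPow_le hσ hQ w k
      _ = _ := by ring
  · rw [← liftedMean_eq_pow_mulVec hσ hP hQ]
    exact norm_liftedMean_le hσ hQ hC0 hC w k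

/-- Splitting a product at time `k` restarts the chain from a random state, not from `s`, so
submultiplicativity of the means is taken instead from the comparable orbit norm. -/
theorem exists_tendsto_radiusSeq (hσ : IsMarkovChain P s μ σ) (hP : ∀ i j, 0 ≤ P i j)
    (hp : 0 < p) (hD0 : 0 ≤ D) (hD : IsDominated p M nMat f e D) (hMat : IsNorm nMat) :
    ∃ L, Tendsto (radiusSeq p M nMat μ σ) atTop (𝓝 L) := by
  obtain ⟨v, C₁, C₂, hC₁, hC₂, h₁, h₂⟩ := exists_integral_pow_le_orbit hσ hP hD0 hD hMat
  obtain ⟨E, hE0, hE⟩ := exists_norm_orbit_submul (liftedMatrix p P M) v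
  have h0 : ∀ k, 0 ≤ ∫ ω, nMat (matProd M (fun l => σ l ω) k) ^ p ∂μ := fun k =>
    integral_nonneg fun ω => pow_nonneg (apply_nonneg _ _) _
  refine exists_tendsto_root (D := C₁ * (E * C₂ * C₂)) h0 (fun k l => ?_) (Nat.cast_pos.2 hp)
  have hk := h0 k
  calc _ ≤ C₁ * (E * ‖(liftedMatrix p P M ^ k) *ᵥ v‖ * ‖(liftedMatrix p P M ^ l) *ᵥ v‖) := by
        refine (h₁ _).trans ?_
        gcongr
        exact hE k l
    _ ≤ C₁ * (E * (C₂ * ∫ ω, nMat (matProd M (fun l => σ l ω) k) ^ p ∂μ) *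
          (C₂ * ∫ ω, nMat (matProd M (fun l => σ l ω) l) ^ p ∂μ)) := by
        gcongr
        · exact h₂ k
        · exact h₂ l
    _ = _ := by ring

theorem expDecay_integral_of_specRadius_lt_one (hσ : IsMarkovChain P s μ σ)
    (hP : ∀ i j, 0 ≤ P i j) (hD0 : 0 ≤ D) (hD : IsDominated p M nMat f e D) (hMat : IsNorm nMat)
    (h : specRadius (liftedMatrix p P M) < 1) :
    ExpDecay fun k => ∫ ω, nMat (matProd M (fun l => σ l ω) k) ^ p ∂μ := by
  obtain ⟨v, C₁, C₂, hC₁, hC₂, h₁, h₂⟩ := exists_integral_pow_le_orbit hσ hP hD0 hD hMat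
  have hv : ExpDecay fun k => ‖(liftedMatrix p P M ^ k) *ᵥ v‖ := by
    refine (ExpDecay.sum Finset.univ fun a _ => ExpDecay.sum Finset.univ fun b _ =>
      (expDecay_of_specRadius_lt_one h a b).const_mul (abs_nonneg (v b))).mono fun k => ?_
    refine (pi_norm_le_iff_of_nonneg (by positivity)).2 fun a => ?_
    calc ‖((liftedMatrix p P M ^ k) *ᵥ v) a‖
        ≤ ∑ b, ‖(liftedMatrix p P M ^ k) a b * v b‖ := norm_sum_le _ _
      _ = ∑ b, |v b| * |(liftedMatrix p P M ^ k) a b| := by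
          simp only [norm_mul, Real.norm_eq_abs, mul_comm]
      _ ≤ _ := Finset.single_le_sum
          (f := fun a => ∑ b, |v b| * |(liftedMatrix p P M ^ k) a b|)
          (fun _ _ => by positivity) (Finset.mem_univ a)
  exact (hv.const_mul hC₁).mono h₁

/-- The hypothesis concerns only tensors `x^{⊗p}`, which need not span. Domination needs no others:
decay along the `e a` controls the mean product norm, and this bounds the lifted mean of every
tensor, in particular of basis tensors. -/
theorem expDecay_entry_of_moment (hσ : IsMarkovChain P s μ σ) (hP : ∀ i j, 0 ≤ P i j)
    (hD0 : 0 ≤ D) (hD : IsDominated p M nMat f e D) (hMat : IsNorm nMat)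
    (h : ∀ x, ExpDecay fun k => ‖∫ ω, vecKronPow p (traj M (fun l => σ l ω) x k) ∂μ‖)
    (a : Fin N × (Fin p → Fin d)) (g : Fin p → Fin d) :
    ExpDecay fun k => |(liftedMatrix p P M ^ k) a (s, g)| := by
  have hQ := isProductProcess_matProd_delay M
  obtain ⟨C, hC0, hC⟩ := hMat.exists_norm_kronPow_mulVec_le p
  obtain ⟨F, hF0, hF⟩ := exists_functional_le_norm f
  have hB : ExpDecay fun k => ∫ ω, nMat (matProd M (delay fun l => σ l ω) k) ^ p ∂μ := by
    refine (((ExpDecay.sum Finset.univ fun a _ => h (e a)).const_mul hF0).const_mul hD0).mono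
      fun k => ?_
    refine (integral_pow_le_of_dominated hσ hQ (fun k i => hD (delay i) k) k).trans ?_
    gcongr
    refine (hF _).trans ?_
    gcongr
    have hsum : ∀ ω, kronPow p (matProd M (delay fun l => σ l ω) k) *ᵥ ∑ a, vecKronPow p (e a) =
        ∑ a, vecKronPow p (traj M (fun l => σ l ω) (e a) k) := fun ω => by
      rw [Matrix.mulVec_sum]
      simp only [kronPow_mulVec_vecKronPow, traj_eq_matProd_delay]
    rw [integral_congr_ae (ae_of_all _ hsum), integral_finsetSum]
    · exact norm_sum_le _ _
    · intro a _
      simp only [traj_eq_matProd_delay, ← kronPow_mulVec_vecKronPow]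
      exact hσ.integrable_comp (hQ.dependsOn_kronPow k _)
  refine (hB.const_mul (c := C * ‖(Pi.single g 1 : (Fin p → Fin d) → ℝ)‖) (by positivity)).mono
    fun k => ?_
  have h1 := norm_liftedMean_le hσ hQ hC0 hC (Pi.single g 1) k
  rw [liftedMean_eq_pow_mulVec hσ hP hQ, liftedMean_zero_single hσ hQ] at h1
  have h2 := (norm_le_pi_norm _ a).trans h1
  simpa using h2

/-- The state at time `k + 1` is `A_k ⋯ A_1` applied to `A_0 x`; the extra factor `A_0` is absorbed
in the sum `R` of the norms of all the `M j`. -/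
theorem exists_integral_traj_pow_le (hσ : IsMarkovChain P s μ σ)
    {nVec : Seminorm ℝ (Fin d → ℝ)} (hVec : IsNorm nVec) (hMat : IsNorm nMat) :
    ∃ C ≥ (0 : ℝ), ∀ x k, ∫ ω, nVec (traj M (fun l => σ l ω) x (k + 1)) ^ p ∂μ ≤
      C * (∫ ω, nMat (matProd M (fun l => σ l ω) k) ^ p ∂μ) * nVec x ^ p := by
  obtain ⟨C, hC0, hC⟩ := hMat.exists_mulVec_le hVec
  have hQ := isProductProcess_matProd M
  set R := ∑ j, nMat (M j)
  have hR0 : 0 ≤ R := Finset.sum_nonneg fun j _ => apply_nonneg _ _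
  have hR : ∀ j, nMat (M j) ≤ R := fun j =>
    Finset.single_le_sum (f := fun j => nMat (M j)) (fun j _ => apply_nonneg _ _)
      (Finset.mem_univ j)
  refine ⟨(C * C * R) ^ p, by positivity, fun x k => ?_⟩
  rw [mul_right_comm, ← integral_const_mul]
  refine integral_mono_of_nonneg (ae_of_all _ fun ω => pow_nonneg (apply_nonneg _ _) _)
    ((hσ.integrable_comp (hQ.dependsOn_seminorm_pow k nMat)).const_mul _)
    (ae_of_all _ fun ω => ?_)
  simp only
  rw [← mul_pow, ← mul_pow, traj_eq_matProd_delay, matProd_delay_succ, ← Matrix.mulVec_mulVec]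
  have h1 : 0 ≤ nMat (matProd M (fun l => σ l ω) k) := apply_nonneg _ _
  have h2 : 0 ≤ nVec x := apply_nonneg _ _
  refine pow_le_pow_left₀ (apply_nonneg _ _) ?_ _
  calc _ ≤ C * nMat (matProd M (fun l => σ l ω) k) * (C * R * nVec x) := by
        refine (hC _ _).trans ?_
        gcongr
        refine (hC _ _).trans ?_
        gcongr
        exact hR _
    _ = _ := by ring

end Chain

end SwitchedSystem

/-! ### The main theorem -/

theorem theorem4 {N d : ℕ} (p : ℕ)
    (P : Matrix (Fin N) (Fin N) ℝ) (hP : P ∈ Matrix.rowStochastic ℝ (Fin N))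
    (M : Fin N → Matrix (Fin d) (Fin d) ℝ)
    {Ω : Fin N → Type*} [∀ s, MeasurableSpace (Ω s)]
    (μ : ∀ s, Measure (Ω s)) [∀ s, IsProbabilityMeasure (μ s)]
    (σ : ∀ s, ℕ → Ω s → Fin N)
    (hσ : ∀ s, SwitchedSystem.IsMarkovChain P s (μ s) (σ s))
    (nVec : Seminorm ℝ (Fin d → ℝ)) (hVec : SwitchedSystem.IsNorm nVec)
    (nMat : Seminorm ℝ (Matrix (Fin d) (Fin d) ℝ)) (hMat : SwitchedSystem.IsNorm nMat)
    (nTens : Seminorm ℝ ((Fin p → Fin d) → ℝ)) (hTens : SwitchedSystem.IsNorm nTens)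
    (hp : p = 2 ∨ (p = 1 ∧ ∃ K : Set (Fin d → ℝ),
      SwitchedSystem.IsProperCone K ∧ SwitchedSystem.LeavesInvariant M K)) :
    (∀ s, Tendsto (SwitchedSystem.radiusSeq p M nMat (μ s) (σ s)) atTop
      (𝓝 (SwitchedSystem.pRadius p M nMat (μ s) (σ s)))) ∧
    List.TFAE [
      ∀ s, SwitchedSystem.pRadius p M nMat (μ s) (σ s) < 1,
      SwitchedSystem.IsMeanStable p M nVec μ σ,
      SwitchedSystem.IsMomentStable p M nVec nTens μ σ,
      SwitchedSystem.specRadius (SwitchedSystem.liftedMatrix p P M) < 1] := by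
  open SwitchedSystem in
  have hP0 : ∀ i j, 0 ≤ P i j := hP.1
  have hp0 : 0 < p := by
    rcases hp with rfl | ⟨rfl, -⟩ <;> norm_num
  obtain ⟨f, m, e, D, hD0, hD⟩ : ∃ (f : ((Fin p → Fin d) → ℝ) →ₗ[ℝ] ℝ) (m : ℕ)
      (e : Fin m → Fin d → ℝ) (D : ℝ), 0 ≤ D ∧ IsDominated p M nMat f e D := by
    rcases hp with rfl | ⟨rfl, K, hK, hM⟩
    · exact exists_isDominated_two M nMat
    · exact exists_isDominated_one hK hM nMat
  have hlim : ∀ s, Tendsto (radiusSeq p M nMat (μ s) (σ s)) atTop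
      (𝓝 (pRadius p M nMat (μ s) (σ s))) := fun s =>
    tendsto_nhds_limUnder (exists_tendsto_radiusSeq (hσ s) hP0 hp0 hD0 hD hMat)
  have hp0' : (0 : ℝ) < p := Nat.cast_pos.2 hp0
  have hB0 : ∀ s k, 0 ≤ ∫ ω, nMat (matProd M (fun l => σ s l ω) k) ^ p ∂(μ s) := fun s k =>
    integral_nonneg fun ω => pow_nonneg (apply_nonneg _ _) _
  refine ⟨hlim, ?_⟩
  tfae_have 1 → 2 := by
    intro h
    choose c hc0 hc using fun s => exists_integral_traj_pow_le (p := p) (M := M) (hσ s) hVec hMat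
    have hdec : ∀ s, ExpDecay fun k => ∫ ω, nMat (matProd M (fun l => σ s l ω) k) ^ p ∂(μ s) := by
      intro s
      obtain ⟨r, hr, hr1⟩ := exists_between (h s)
      exact expDecay_of_eventually_root_lt (hB0 s) hp0' hr1
        ((hlim s).eventually (gt_mem_nhds hr))
    -- Summing over initial states makes the constants uniform in `s`; the value 1 at `k = 0`
    -- accounts for the initial vector, and the shift for the factor `A_0`.
    set b : ℕ → ℝ := fun k => if k = 0 then 1 else
      ∑ s, c s * ∫ ω, nMat (matProd M (fun l => σ s l ω) (k - 1)) ^ p ∂(μ s) with hb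
    obtain ⟨C, hC, β, hβ, H⟩ : ExpDecay b := expDecay_of_succ <| by
      simpa [hb] using ExpDecay.sum Finset.univ fun s _ => (hdec s).const_mul (hc0 s)
    refine ⟨C, hC, β, hβ, fun s x k => ?_⟩
    have hx : 0 ≤ nVec x ^ p := pow_nonneg (apply_nonneg _ _) _
    refine le_trans ?_ (mul_le_mul_of_nonneg_right (H k) hx)
    cases k with
    | zero => simp [hb, traj]
    | succ k =>
      refine (hc s x k).trans (mul_le_mul_of_nonneg_right ?_ hx)
      simp only [hb, Nat.add_eq_zero_iff, one_ne_zero, and_false, if_false, Nat.add_sub_cancel]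
      exact Finset.single_le_sum
        (f := fun s => c s * ∫ ω, nMat (matProd M (fun l => σ s l ω) k) ^ p ∂(μ s))
        (fun s _ => mul_nonneg (hc0 s) (hB0 s k)) (Finset.mem_univ s)
  tfae_have 2 → 3 := by
    rintro ⟨C, hC, β, hβ, H⟩
    obtain ⟨C₁, hC₁, h₁⟩ := hVec.exists_norm_le
    obtain ⟨C₂, hC₂, h₂⟩ := exists_seminorm_le nTens
    refine ⟨C₂ * (C₁ ^ p * C), by positivity, β, hβ, fun s x k => ?_⟩
    have hdep : DependsOn (fun i => nVec (traj M i x k) ^ p) (Set.Iic k) := fun i j h => by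
      have := dependsOn_matProd_delay M k h
      simp only at this
      simp only [traj_eq_matProd_delay, this]
    calc _ ≤ C₂ * ‖∫ ω, vecKronPow p (traj M (fun l => σ s l ω) x k) ∂(μ s)‖ := h₂ _
      _ ≤ C₂ * ∫ ω, C₁ ^ p * nVec (traj M (fun l => σ s l ω) x k) ^ p ∂(μ s) := by
          gcongr
          refine norm_integral_le_of_norm_le (((hσ s).integrable_comp hdep).const_mul _)
            (ae_of_all _ fun ω => ?_)
          refine (norm_vecKronPow_le p _).trans ?_
          rw [← mul_pow]
          gcongr
          exact h₁ _
      _ ≤ C₂ * (C₁ ^ p * (C * Real.exp (-β * k) * nVec x ^ p)) := by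
          rw [integral_const_mul]
          gcongr
          exact H s x k
      _ = _ := by ring
  tfae_have 3 → 4 := by
    rintro ⟨C, hC, β, hβ, H⟩
    obtain ⟨C₁, hC₁, h₁⟩ := hTens.exists_norm_le
    -- Column `b` is reached by the chain started at its block `b.1`, so stability from every
    -- initial state is used.
    refine specRadius_lt_one_of_expDecay fun a b =>
      expDecay_entry_of_moment (hσ b.1) hP0 hD0 hD hMat (fun x => ?_) a b.2
    have hx : 0 ≤ nVec x ^ p := pow_nonneg (apply_nonneg _ _) _
    have hexp : ExpDecay fun k : ℕ => C * Real.exp (-β * k) := ⟨C, hC, β, hβ, fun k => le_rfl⟩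
    refine ((hexp.const_mul hx).const_mul hC₁.le).mono fun k => (h₁ _).trans ?_
    gcongr
    exact (H b.1 x k).trans_eq (mul_comm _ _)
  tfae_have 4 → 1 := fun h s =>
    lt_one_of_tendsto_root (hB0 s) hp0' (hlim s)
      (expDecay_integral_of_specRadius_lt_one (hσ s) hP0 hD0 hD hMat h)
  tfae_finish
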